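/- Let $d\ge 1$. For a closed set $M\subset\mathbb R^d$ let $\mathrm{Unp}(M)$ be the set of points of $\mathbb R^d$ that have a unique closest point in $M$ (Euclidean distance). For $x\in M$ put $\mathrm{reach}(M,x)=\sup\{r>0:\mathring{\mathcal B}(x,r)\subset \mathrm{Unp}(M)\}\in[0,\infty]$ (with $\sup\emptyset=0$), where $\mathring{\mathcal B}(x,r)$ is the open ball, and $\mathrm{reach}(M)=\inf_{x\in M}\mathrm{reach}(M,x)$. Let $\mathcal T$ be the set of all probability densities on $\mathbb R^d$ with respect to Lebesgue measure (modulo equality almost everywhere), with the metric of the $L^1$ norm $\|\cdot\|_1$. For $f\in\mathcal T$ let $\mathrm{supp}(f)$ be the closed support of the probability measure $f(x)\,dx$, and let $\alpha(f)=1$ if $\mathrm{reach}(\mathrm{supp}(f))=0$ and $\alpha(f)=0$ otherwise. Then: 1. If $f\in\mathcal T$ and $\mathrm{reach}(\mathrm{supp}(f))>0$, then for every $\delta>0$ there is a compactly supported $f_\delta\in\mathcal T$ with $\|f-f_\delta\|_1<\delta$ and $\mathrm{reach}(\mathrm{supp}(f_\delta))=0$. 2. If $f\in\mathcal T$ and $\mathrm{reach}(\mathrm{supp}(f))=0$,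 then for every $\varepsilon>0$ there is a compactly supported $f_\varepsilon\in\mathcal T$ with $\|f-f_\varepsilon\|_1<\varepsilon$ and $\mathrm{reach}(\mathrm{supp}(f_\varepsilon))>0$. 3. The functional $\alpha:\mathcal T\to\mathbb R$ is discontinuous at every $f\in\mathcal T$. 4. $\alpha$ is not consistently estimable on $\mathcal T$: there is no sequence of measurable functions $T_n:(\mathbb R^d)^n\to\mathbb R$ such that, for every $f\in\mathcal T$, if $X_1,X_2,\dots$ are iid with density $f$, then $T_n(X_1,\dots,X_n)\to\alpha(f)$ in probability. -/

import Mathlib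

open MeasureTheory Filter Topology
open scoped ENNReal NNReal

noncomputable section

/-! ### Sets of positive reach in a metric space -/

/-- `unp M` is the set of points that have exactly one closest point in `M`. -/
def unp {X : Type*} [MetricSpace X] (M : Set X) : Set X :=
  {x | ∃! p, p ∈ M ∧ ∀ q ∈ M, dist x p ≤ dist x q}

/-- The local reach of `M` at `x`: the supremum, in `[0, ∞]`, of the radii `r > 0` such that the
open ball of radius `r` about `x` is contained in `unp M` (it is `0` if there is no such radius). -/
def reachAt {X : Type*} [MetricSpace X] (M : Set X) (x : X) : ℝ≥0∞ :=
  ⨆ (r : ℝ≥0) (_ : 0 < r) (_ : Metric.ball x (r : ℝ) ⊆ unp M), (r : ℝ≥0∞)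

/-- The reach of `M`: the infimum of the local reaches over the points of `M`. -/
def reach {X : Type*} [MetricSpace X] (M : Set X) : ℝ≥0∞ :=
  ⨅ x ∈ M, reachAt M x

/-! ### Densities -/

/-- The probability densities on `ℝ^d` with respect to Lebesgue measure, up to equality almost
everywhere, with the metric of the `L¹` norm (as a subspace of `L¹`). -/
abbrev Density (d : ℕ) : Type :=
  {f : Lp ℝ 1 (volume : Measure (EuclideanSpace ℝ (Fin d))) //
    (∀ᵐ x, 0 ≤ f x) ∧ ∫ x, f x = 1}

namespace Density

/-- The probability measure on `ℝ^d` that has density `f`. -/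
def law {d : ℕ} (f : Density d) : Measure (EuclideanSpace ℝ (Fin d)) :=
  volume.withDensity fun x => ENNReal.ofReal (f.1 x)

instance isProbabilityMeasure_law {d : ℕ} (f : Density d) : IsProbabilityMeasure f.law := by
  constructor
  rw [law, withDensity_apply _ MeasurableSet.univ, Measure.restrict_univ,
    ← ofReal_integral_eq_lintegral_ofReal (L1.integrable_coeFn f.1) f.2.1, f.2.2,
    ENNReal.ofReal_one]

/-- The support of a density: the closed support of its law, i.e. the set of points all of whose
neighbourhoods have positive probability. -/
def supp {d : ℕ} (f : Density d) : Set (EuclideanSpace ℝ (Fin d)) :=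
  f.law.support

open Classical in
/-- The functional that indicates whether the support of a density has reach zero. -/
def zeroReach {d : ℕ} (f : Density d) : ℝ :=
  if reach f.supp = 0 then 1 else 0

/-- A real functional `Φ` of a density is consistently estimable if there are estimators
`T n`, measurable functions of a sample of size `n`, such that for every density `f`, when the
samples are iid from `f` (so that the sample of size `n` has law `f.law ⊗ ⋯ ⊗ f.law`),
`T n` converges to `Φ f` in probability. -/
def ConsistentlyEstimable {d : ℕ} (Φ : Density d → ℝ) : Prop :=
  ∃ T : (n : ℕ) → (Fin n → EuclideanSpace ℝ (Fin d)) → ℝ,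
    (∀ n, Measurable (T n)) ∧
    ∀ f : Density d, ∀ ε : ℝ, 0 < ε →
      Tendsto
        (fun n => Measure.pi (fun _ : Fin n => f.law) {x | ε ≤ |T n x - Φ f|})
        atTop (𝓝 0)

end Density

end

/-! Both values of the functional are taken on dense sets of densities, through compactly supported
densities whose supports have reach `0` or `∞`. The law of `f` is nearly concentrated on an annulus
`η < ‖x‖ < R`. If a bounded open `U` carries almost all the mass, scaling `f` on `U` and adding a
small positive constant there gives a nearby density with support exactly `closure U`
(`exists_supp_eq_closure`). For `U` a ball the support is convex, so its reach is infinite. For `U`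
the annulus together with thin shells shrinking to the origin, mid-gap points have two closest
points arbitrarily near, so the reach is zero.

Discontinuity is then immediate. For the estimation claim, the probability that `T n ≥ 1/2` is
continuous in the density and would converge pointwise to the functional. Baire's theorem on the
complete space of densities rules this out when both values are dense. -/

/-! ### Reach -/

/-- A point equidistant from two distinct closest points of `M` bounds the reach of `M`. -/
lemma reach_le_of_two_closest {X : Type*} [MetricSpace X] {M : Set X} {p q m : X}
    (hp : p ∈ M) (hq : q ∈ M) (hpq : p ≠ q)
    (hmp : ∀ z ∈ M, dist m p ≤ dist m z) (hmq : ∀ z ∈ M, dist m q ≤ dist m z) :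
    reach M ≤ ENNReal.ofReal (dist m p) := by
  refine (iInf₂_le p hp).trans (iSup_le fun r => iSup_le fun _ => iSup_le fun hr => ?_)
  rw [← ENNReal.ofReal_coe_nnreal]
  refine ENNReal.ofReal_le_ofReal (not_lt.1 fun hlt => ?_)
  obtain ⟨_, _, hu⟩ := hr (Metric.mem_ball.2 hlt)
  exact hpq ((hu p ⟨hp, hmp⟩).trans (hu q ⟨hq, hmq⟩).symm)

lemma reach_eq_top_of_unp_eq_univ {X : Type*} [MetricSpace X] {M : Set X}
    (h : unp M = Set.univ) : reach M = ∞ := by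
  simp only [reach, reachAt, h, Set.subset_univ, iSup_pos, iInf_eq_top]
  refine fun x _ => ENNReal.eq_top_of_forall_nnreal_le fun r => ?_
  -- Admissible radii must be positive and `r` may be `0`; hence `r + 1`.
  calc (r : ℝ≥0∞) ≤ ((r + 1 : ℝ≥0) : ℝ≥0∞) := by exact_mod_cast le_self_add
    _ ≤ _ := le_iSup₂_of_le (r + 1) (by positivity) le_rfl

/-- Every point has a unique closest point in a nonempty compact convex set. -/
lemma unp_eq_univ_of_convex {E : Type*} [NormedAddCommGroup E] [InnerProductSpace ℝ E]
    {M : Set E} (hc : IsCompact M) (hne : M.Nonempty) (hM : Convex ℝ M) :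
    unp M = Set.univ := by
  refine Set.eq_univ_of_forall fun x => ?_
  obtain ⟨p, hp, hmin⟩ := hc.exists_isMinOn hne
    (continuous_const.dist continuous_id : Continuous fun y => dist x y).continuousOn
  refine ⟨p, ⟨hp, fun q hq => hmin hq⟩, fun q ⟨hq, hqmin⟩ => ?_⟩
  by_contra hne
  have heq : ‖x - p‖ = ‖x - q‖ := by
    simpa [dist_eq_norm] using le_antisymm (hmin hq) (hqmin p hp)
  -- Strict convexity of the norm: the midpoint of two distinct closest points would be strictly
  -- closer.
  have hlt := (norm_midpoint_lt_iff heq).2 fun h => hne (sub_right_injective h).symm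
  have hmid : (1 / 2 : ℝ) • p + (1 / 2 : ℝ) • q ∈ M :=
    hM hp hq (by norm_num) (by norm_num) (by norm_num)
  have hle : ‖x - p‖ ≤ ‖x - ((1 / 2 : ℝ) • p + (1 / 2 : ℝ) • q)‖ := by
    simpa [dist_eq_norm] using hmin hmid
  have h2 : x - ((1 / 2 : ℝ) • p + (1 / 2 : ℝ) • q) = (1 / 2 : ℝ) • (x - p + (x - q)) := by
    module
  rw [h2] at hle
  exact absurd hlt hle.not_gt

/-- The radii in `(η, R)`, together with a sequence of intervals in `(0, η)` that shrink to `0`. -/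
def gapRadii (η R : ℝ) : Set ℝ :=
  Set.Ioo η R ∪ ⋃ k : ℕ, Set.Ioo (η / (2 * k + 3)) (η / (2 * k + 2))

lemma isOpen_gapRadii (η R : ℝ) : IsOpen (gapRadii η R) :=
  isOpen_Ioo.union (isOpen_iUnion fun _ => isOpen_Ioo)

lemma gapRadii_subset {η R : ℝ} (hη : 0 < η) (hR : η < R) : gapRadii η R ⊆ Set.Ioo 0 R := by
  rintro t (ht | ht)
  · exact ⟨hη.trans ht.1, ht.2⟩
  · obtain ⟨k, h1, h2⟩ := Set.mem_iUnion.1 ht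
    refine ⟨lt_trans (by positivity) h1, h2.trans (lt_of_le_of_lt ?_ hR)⟩
    exact div_le_self hη.le (by linarith [(Nat.cast_nonneg k : (0 : ℝ) ≤ k)])

/-- This gap lies between the intervals of index `k + 1` and `k`: membership in the interval of
index `j` would force `k < j < k + 1`. -/
lemma notMem_gapRadii {η R : ℝ} (hη : 0 < η) (k : ℕ) {t : ℝ}
    (h1 : η / (2 * k + 4) < t) (h2 : t < η / (2 * k + 3)) : t ∉ gapRadii η R := by
  have ht : 0 < t := lt_trans (by positivity) h1
  rw [div_lt_iff₀ (by positivity)] at h1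
  rw [lt_div_iff₀ (by positivity)] at h2
  rintro (h | h)
  · have hk : (0 : ℝ) ≤ k := Nat.cast_nonneg k
    nlinarith [h.1, mul_nonneg ht.le hk]
  · obtain ⟨j, h3, h4⟩ := Set.mem_iUnion.1 h
    rw [div_lt_iff₀ (by positivity)] at h3
    rw [lt_div_iff₀ (by positivity)] at h4
    have h5 : (2 * k + 3 : ℝ) < 2 * j + 3 := lt_of_mul_lt_mul_left (h2.trans h3) ht.le
    have h6 : (2 * j + 2 : ℝ) < 2 * k + 4 := lt_of_mul_lt_mul_left (h4.trans h1) ht.le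
    have h7 : k < j := by exact_mod_cast (by linarith : (k : ℝ) < j)
    have h8 : j < k + 1 := by exact_mod_cast (by linarith : (j : ℝ) < k + 1)
    omega

/-- The points with norm in `gapRadii η R`, a union of concentric shells. -/
def shells (E : Type*) [NormedAddCommGroup E] (η R : ℝ) : Set E :=
  {x | ‖x‖ ∈ gapRadii η R}

section Shells

variable {E : Type*} [NormedAddCommGroup E]

lemma isOpen_shells (η R : ℝ) : IsOpen (shells E η R) :=
  (isOpen_gapRadii η R).preimage continuous_norm

lemma shells_subset_ball {η R : ℝ} (hη : 0 < η) (hR : η < R) :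
    shells E η R ⊆ Metric.ball 0 R := fun _ hx =>
  mem_ball_zero_iff.2 (gapRadii_subset hη hR hx).2

lemma smul_mem_closure_shells [NormedSpace ℝ E] {η R : ℝ} (hη : 0 < η) (hR : η < R) {u : E}
    (hu : ‖u‖ = 1) {t : ℝ} (ht : t ∈ closure (gapRadii η R)) :
    t • u ∈ closure (shells E η R) := by
  have h : Set.MapsTo (fun t : ℝ => t • u) (gapRadii η R) (shells E η R) := fun s hs => by
    have := (gapRadii_subset hη hR hs).1
    simpa [shells, norm_smul, hu, abs_of_pos this] using hs
  exact map_mem_closure (f := fun t : ℝ => t • u) (by fun_prop) ht h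

lemma norm_notMem_Ioo_of_mem_closure_shells {η R : ℝ} (hη : 0 < η) (k : ℕ) {z : E}
    (hz : z ∈ closure (shells E η R)) :
    ‖z‖ ∉ Set.Ioo (η / (2 * k + 4)) (η / (2 * k + 3)) := by
  have hcl : IsClosed {x : E | ‖x‖ ∉ Set.Ioo (η / (2 * k + 4)) (η / (2 * k + 3))} :=
    (isOpen_Ioo.preimage continuous_norm).isClosed_compl
  have hsub : shells E η R ⊆ {x : E | ‖x‖ ∉ Set.Ioo (η / (2 * k + 4)) (η / (2 * k + 3))} :=
    fun x hx hx' => notMem_gapRadii hη k hx'.1 hx'.2 hx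
  exact closure_minimal hsub hcl hz

lemma reach_closure_shells_le [NormedSpace ℝ E] [Nontrivial E] {η R : ℝ} (hη : 0 < η)
    (hR : η < R) (k : ℕ) : reach (closure (shells E η R)) ≤ ENNReal.ofReal (η / (k + 1)) := by
  obtain ⟨u, hu⟩ := exists_norm_eq E (zero_le_one (α := ℝ))
  set a : ℝ := η / (2 * k + 4) with ha
  set b : ℝ := η / (2 * k + 3) with hb
  have hab : a < b := div_lt_div_of_pos_left hη (by positivity) (by linarith)
  have ha0 : 0 < a := by positivity
  -- `a` is the right end of the interval of index `k + 1`, and `b` the left end of the one of index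
  -- `k`.
  have haC : a ∈ closure (gapRadii η R) := by
    have h : a ∈ closure (Set.Ioo (η / (2 * (k + 1 : ℕ) + 3)) (η / (2 * (k + 1 : ℕ) + 2))) := by
      have hlt : η / (2 * ((k + 1 : ℕ) : ℝ) + 3) < η / (2 * (k + 1 : ℕ) + 2) :=
        div_lt_div_of_pos_left hη (by positivity) (by linarith)
      rw [closure_Ioo hlt.ne]
      have : a = η / (2 * (k + 1 : ℕ) + 2) := by rw [ha]; push_cast; ring_nf
      rw [this]
      exact Set.right_mem_Icc.2 hlt.le
    exact closure_mono
      ((Set.subset_iUnion (fun k : ℕ => Set.Ioo (η / (2 * k + 3)) (η / (2 * k + 2))) (k + 1)).trans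
        Set.subset_union_right) h
  have hbC : b ∈ closure (gapRadii η R) := by
    have h : b ∈ closure (Set.Ioo (η / (2 * k + 3)) (η / (2 * k + 2))) := by
      have hlt : η / (2 * k + 3) < η / (2 * k + 2) :=
        div_lt_div_of_pos_left hη (by positivity) (by linarith)
      rw [closure_Ioo hlt.ne]
      exact Set.left_mem_Icc.2 hlt.le
    exact closure_mono
      ((Set.subset_iUnion (fun k : ℕ => Set.Ioo (η / (2 * k + 3)) (η / (2 * k + 2))) k).trans
        Set.subset_union_right) h
  have hdist : ∀ s t : ℝ, dist (s • u) (t • u) = |s - t| := fun s t => by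
    rw [dist_eq_norm, ← sub_smul, norm_smul, hu, mul_one, Real.norm_eq_abs]
  set m : ℝ := (a + b) / 2 with hm
  have hma : dist (m • u) (a • u) = (b - a) / 2 := by
    rw [hdist, abs_of_nonneg (by linarith)]; linarith
  have hmb : dist (m • u) (b • u) = (b - a) / 2 := by
    rw [hdist, abs_of_nonpos (by linarith)]; linarith
  -- The norm is 1-Lipschitz and `‖z‖` avoids `(a, b)`, whose midpoint is `‖m • u‖`.
  have hmin : ∀ z ∈ closure (shells E η R), (b - a) / 2 ≤ dist (m • u) z := fun z hz => by
    have hz' := norm_notMem_Ioo_of_mem_closure_shells hη k hz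
    have hmn : ‖m • u‖ = m := by
      rw [norm_smul, hu, mul_one, Real.norm_eq_abs, abs_of_pos (by linarith)]
    have h := abs_le.1 (abs_norm_sub_norm_le (m • u) z)
    rw [hmn, ← dist_eq_norm] at h
    rcases not_and_or.1 hz' with h' | h'
    · linarith [not_lt.1 h', h.2]
    · linarith [not_lt.1 h', h.1]
  refine (reach_le_of_two_closest (smul_mem_closure_shells hη hR hu haC)
    (smul_mem_closure_shells hη hR hu hbC) ?_ (m := m • u) (fun z hz => hma ▸ hmin z hz)
    (fun z hz => hmb ▸ hmin z hz)).trans (ENNReal.ofReal_le_ofReal ?_)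
  · rw [← dist_pos, hdist]
    exact abs_pos.2 (by linarith)
  · rw [hma]
    have : b ≤ η / (k + 1) := div_le_div_of_nonneg_left hη.le (by positivity) (by linarith)
    linarith

lemma reach_closure_shells [NormedSpace ℝ E] [Nontrivial E] {η R : ℝ} (hη : 0 < η)
    (hR : η < R) : reach (closure (shells E η R)) = 0 := by
  have hlim : Tendsto (fun k : ℕ => ENNReal.ofReal (η / (k + 1))) atTop (𝓝 0) := by
    have h := (tendsto_const_div_atTop_nhds_zero_nat η).comp (tendsto_add_atTop_nat 1)
    simpa using ENNReal.tendsto_ofReal h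
  exact le_antisymm (ge_of_tendsto' hlim (reach_closure_shells_le hη hR)) bot_le

end Shells

/-! ### Approximation of densities with a prescribed support -/

namespace Density

variable {d : ℕ}

lemma law_real_apply (f : Density d) {s : Set (EuclideanSpace ℝ (Fin d))}
    (hs : MeasurableSet s) : f.law.real s = ∫ x in s, f.1 x := by
  rw [Measure.real, law, withDensity_apply _ hs,
    ← ofReal_integral_eq_lintegral_ofReal (L1.integrable_coeFn f.1).integrableOn
      (ae_restrict_of_ae f.2.1),
    ENNReal.toReal_ofReal (integral_nonneg_of_ae (ae_restrict_of_ae f.2.1))]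

/-- A density that is almost everywhere positive on an open set and vanishes outside it
has the closure of this set as its support. -/
lemma supp_eq_closure (g : Density d) {U : Set (EuclideanSpace ℝ (Fin d))} (hU : IsOpen U)
    (hpos : ∀ᵐ x, x ∈ U → 0 < g.1 x) (hzero : ∀ᵐ x, x ∉ U → g.1 x = 0) :
    g.supp = closure U := by
  have hlaw : g.law = (volume.restrict U).withDensity fun x => ENNReal.ofReal (g.1 x) := by
    rw [law, ← restrict_withDensity hU.measurableSet]
    refine (Measure.restrict_eq_self_of_ae_mem ?_).symm
    rw [ae_withDensity_iff (by fun_prop)]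
    filter_upwards [hzero] with x hx h
    by_contra hxU
    simp [hx hxU] at h
  have hac : volume.restrict U ≪ g.law := by
    rw [hlaw]
    refine withDensity_absolutelyContinuous' (by fun_prop) ?_
    rw [ae_restrict_iff' hU.measurableSet]
    filter_upwards [hpos] with x hx hxU
    simpa using hx hxU
  refine subset_antisymm ?_ (closure_minimal ?_ Measure.isClosed_support)
  · refine (Measure.AbsolutelyContinuous.support_mono
      (hlaw ▸ withDensity_absolutelyContinuous _ _)).trans
      (Measure.support_restrict_subset.trans Set.inter_subset_left)
  · intro x hx
    refine hac.support_mono (Measure.interior_inter_support ?_)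
    rw [hU.interior_eq, Measure.support_eq_univ]
    exact ⟨hx, trivial⟩

/-- If the law of `f` gives small mass to the complement of a bounded open set, then `f` is close
to a density supported on the closure of this set. -/
lemma exists_supp_eq_closure (f : Density d) {U : Set (EuclideanSpace ℝ (Fin d))}
    (hU : IsOpen U) (hUb : Bornology.IsBounded U) (hne : U.Nonempty) {ε : ℝ}
    (h : f.law.real Uᶜ < ε) :
    ∃ g : Density d, ‖f.1 - g.1‖ < 2 * ε ∧ g.supp = closure U := by
  have hf : Integrable (f.1 : EuclideanSpace ℝ (Fin d) → ℝ) := L1.integrable_coeFn f.1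
  have hVtop : volume U ≠ ∞ := hUb.measure_lt_top.ne
  have hV : 0 < volume.real U := ENNReal.toReal_pos (hU.measure_pos volume hne).ne' hVtop
  set m := f.law.real Uᶜ with hm
  have hm0 : 0 ≤ m := measureReal_nonneg
  have hm1 : m ≤ 1 := measureReal_le_one
  have hfUc : ∫ x in Uᶜ, f.1 x = m := (f.law_real_apply hU.measurableSet.compl).symm
  have hfU : ∫ x in U, f.1 x = 1 - m := by
    have := integral_add_compl hU.measurableSet hf
    rw [hfUc, f.2.2] at this
    linarith
  -- The loss `θ` keeps the added constant `c` positive even when `m = 0`, so that `G` is positive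
  -- where `f` vanishes on `U`.
  obtain ⟨θ, hθ0, hθ1, hθ⟩ : ∃ θ : ℝ, 0 < θ ∧ θ < 1 ∧ m + θ < ε :=
    ⟨min (1 / 2) ((ε - m) / 2), lt_min (by norm_num) (by linarith),
      (min_le_left _ _).trans_lt (by norm_num),
      by linarith [min_le_right (1 / 2) ((ε - m) / 2)]⟩
  set c := (1 - (1 - θ) * (1 - m)) / volume.real U with hc
  have hcV : c * volume.real U = 1 - (1 - θ) * (1 - m) := div_mul_cancel₀ _ hV.ne'
  have hc0 : 0 < c := div_pos (by nlinarith) hV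
  have hconst : ∀ a : ℝ, IntegrableOn (fun _ : EuclideanSpace ℝ (Fin d) => a) U volume :=
    fun a => integrableOn_const hVtop
  have hint : ∀ a : ℝ, IntegrableOn (fun x => a * f.1 x + c) U volume := fun a =>
    (hf.const_mul a).integrableOn.add (hconst c)
  have hval : ∀ a : ℝ, ∫ x in U, (a * f.1 x + c) = a * (1 - m) + c * volume.real U := fun a => by
    rw [integral_add (hf.const_mul a).integrableOn (hconst c), integral_const_mul, hfU,
      setIntegral_const, smul_eq_mul, mul_comm c]
  set G : EuclideanSpace ℝ (Fin d) → ℝ := U.indicator fun x => (1 - θ) * f.1 x + c with hG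
  have hGint : Integrable G := (integrable_indicator_iff hU.measurableSet).2 (hint _)
  have hGae := hGint.coeFn_toL1
  have hGU : ∀ x ∈ U, G x = (1 - θ) * f.1 x + c := fun x hx => Set.indicator_of_mem hx _
  have hGUc : ∀ x ∉ U, G x = 0 := fun x hx => Set.indicator_of_notMem hx _
  have hGpos : ∀ᵐ x, x ∈ U → 0 < G x := by
    filter_upwards [f.2.1] with x hx hxU
    rw [hGU x hxU]
    nlinarith
  refine ⟨⟨hGint.toL1 G, ?_, ?_⟩, ?_, supp_eq_closure _ hU ?_ ?_⟩
  · filter_upwards [hGae, hGpos] with x h1 h2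
    rw [h1]
    by_cases hx : x ∈ U
    · exact (h2 hx).le
    · rw [hGUc x hx]
  · rw [integral_congr_ae hGae, hG, integral_indicator hU.measurableSet, hval, hcV]
    ring
  · have hbd : ∀ᵐ x, ‖(f.1 - hGint.toL1 G) x‖ ≤
        Uᶜ.indicator (fun x => f.1 x) x + U.indicator (fun x => θ * f.1 x + c) x := by
      filter_upwards [hGae, Lp.coeFn_sub f.1 (hGint.toL1 G), f.2.1] with x h1 h2 h3
      rw [h2, Pi.sub_apply, h1, Real.norm_eq_abs]
      by_cases hx : x ∈ U
      · rw [hGU x hx, Set.indicator_of_mem hx, Set.indicator_of_notMem (by simpa using hx),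
          abs_le]
        constructor <;> nlinarith
      · rw [hGUc x hx, Set.indicator_of_notMem hx, Set.indicator_of_mem (by simpa using hx),
          sub_zero, add_zero, abs_of_nonneg h3]
    have hi1 : Integrable (Uᶜ.indicator fun x => f.1 x) :=
      hf.indicator hU.measurableSet.compl
    have hi2 : Integrable (U.indicator fun x => θ * f.1 x + c) :=
      (integrable_indicator_iff hU.measurableSet).2 (hint _)
    rw [L1.norm_eq_integral_norm]
    calc ∫ x, ‖(f.1 - hGint.toL1 G) x‖
        ≤ ∫ x, (Uᶜ.indicator (fun x => f.1 x) x + U.indicator (fun x => θ * f.1 x + c) x) :=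
          integral_mono_ae (L1.integrable_coeFn _).norm (hi1.add hi2) hbd
      _ = m + (θ * (1 - m) + c * volume.real U) := by
          rw [integral_add hi1 hi2, integral_indicator hU.measurableSet.compl,
            integral_indicator hU.measurableSet, hfUc, hval]
      -- The bound equals `2 * m + 2 * θ * (1 - m)`, at most `2 * (m + θ)`.
      _ < 2 * ε := by rw [hcV]; nlinarith
  · filter_upwards [hGae, hGpos] with x h1 h2 hx
    rw [h1]
    exact h2 hx
  · filter_upwards [hGae] with x h1 hx
    rw [h1, hGUc x hx]

/-- The law of a density is concentrated on annuli with inner radius close to `0` and large outer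
radius. -/
lemma exists_annulus [NeZero d] (f : Density d) {ε : ℝ} (hε : 0 < ε) :
    ∃ η R : ℝ, 0 < η ∧ η < R ∧ f.law.real {x | ‖x‖ ∈ Set.Ioo η R}ᶜ < ε := by
  set s : ℕ → Set (EuclideanSpace ℝ (Fin d)) :=
    fun n => {x | ‖x‖ ∈ Set.Ioo (1 / ((n : ℝ) + 2)) (n + 2)}ᶜ with hs
  have hmeas : ∀ n, MeasurableSet (s n) := fun n =>
    (isOpen_Ioo.preimage continuous_norm).measurableSet.compl
  have hanti : Antitone s := fun n k hnk => by
    have hnk' : (n : ℝ) ≤ k := by exact_mod_cast hnk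
    refine Set.compl_subset_compl.2 fun x hx => ?_
    exact ⟨lt_of_le_of_lt (one_div_le_one_div_of_le (by positivity) (by linarith)) hx.1,
      hx.2.trans_le (by linarith)⟩
  have hinter : ⋂ n, s n ⊆ {0} := fun x hx => by
    by_contra hx0
    have hpos : 0 < ‖x‖ := norm_pos_iff.2 hx0
    obtain ⟨n, hn⟩ := exists_nat_gt (max ‖x‖ (1 / ‖x‖))
    refine Set.mem_iInter.1 hx n ⟨?_, ?_⟩
    · rw [one_div_lt (by positivity) hpos]
      linarith [le_max_right ‖x‖ (1 / ‖x‖)]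
    · linarith [le_max_left ‖x‖ (1 / ‖x‖)]
  -- Only the origin may escape all the annuli, and it is a null set in positive dimension.
  have h0 : f.law (⋂ n, s n) = 0 :=
    measure_mono_null hinter (withDensity_absolutelyContinuous _ _ (measure_singleton 0))
  have hlim := tendsto_measure_iInter_atTop (μ := f.law)
    (fun n => (hmeas n).nullMeasurableSet) hanti ⟨0, measure_ne_top _ _⟩
  rw [h0] at hlim
  obtain ⟨n, hn⟩ := (hlim.eventually_lt_const (ENNReal.ofReal_pos.2 hε)).exists
  refine ⟨1 / ((n : ℝ) + 2), n + 2, by positivity, ?_, ?_⟩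
  · rw [div_lt_iff₀ (by positivity)]
    nlinarith [(Nat.cast_nonneg n : (0 : ℝ) ≤ n)]
  · exact (ENNReal.toReal_lt_of_lt_ofReal hn)

/-- The outer annulus alone already carries enough mass; the inner shells serve only to destroy the
reach. -/
lemma exists_reach_eq_zero [NeZero d] (f : Density d) {ε : ℝ} (hε : 0 < ε) :
    ∃ g : Density d, ‖f.1 - g.1‖ < ε ∧ IsCompact g.supp ∧ reach g.supp = 0 := by
  obtain ⟨η, R, hη, hR, h⟩ := f.exists_annulus (half_pos hε)
  have hsub : {x : EuclideanSpace ℝ (Fin d) | ‖x‖ ∈ Set.Ioo η R} ⊆ shells _ η R :=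
    fun x hx => Or.inl hx
  have hb : Bornology.IsBounded (shells (EuclideanSpace ℝ (Fin d)) η R) :=
    Metric.isBounded_ball.subset (shells_subset_ball hη hR)
  obtain ⟨u, hu⟩ := exists_norm_eq (EuclideanSpace ℝ (Fin d)) (c := (η + R) / 2) (by linarith)
  obtain ⟨g, hg, hs⟩ := f.exists_supp_eq_closure (isOpen_shells η R) hb
    ⟨u, hsub (by rw [Set.mem_ofPred_eq, hu]; constructor <;> linarith)⟩
    ((measureReal_mono (Set.compl_subset_compl.2 hsub)).trans_lt h)
  refine ⟨g, by linarith, hs ▸ hb.isCompact_closure, hs ▸ reach_closure_shells hη hR⟩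

lemma exists_reach_eq_top [NeZero d] (f : Density d) {ε : ℝ} (hε : 0 < ε) :
    ∃ g : Density d, ‖f.1 - g.1‖ < ε ∧ IsCompact g.supp ∧ reach g.supp = ∞ := by
  obtain ⟨η, R, hη, hR, h⟩ := f.exists_annulus (half_pos hε)
  have hsub : {x : EuclideanSpace ℝ (Fin d) | ‖x‖ ∈ Set.Ioo η R} ⊆ Metric.ball 0 R :=
    fun x hx => mem_ball_zero_iff.2 hx.2
  obtain ⟨g, hg, hs⟩ := f.exists_supp_eq_closure Metric.isOpen_ball Metric.isBounded_ball
    ⟨0, Metric.mem_ball_self (hη.trans hR)⟩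
    ((measureReal_mono (Set.compl_subset_compl.2 hsub)).trans_lt h)
  rw [closure_ball _ (hη.trans hR).ne'] at hs
  refine ⟨g, by linarith, hs ▸ isCompact_closedBall 0 R, hs ▸ reach_eq_top_of_unp_eq_univ ?_⟩
  exact unp_eq_univ_of_convex (isCompact_closedBall 0 R)
    ⟨0, Metric.mem_closedBall_self (hη.trans hR).le⟩ (convex_closedBall 0 R)

end Density

/-- A real function that takes two distinct values on dense sets is discontinuous everywhere. -/
lemma not_continuousAt_of_dense {X : Type*} [TopologicalSpace X] {φ : X → ℝ} {a b : ℝ}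
    (hab : a ≠ b) (ha : Dense {x | φ x = a}) (hb : Dense {x | φ x = b}) (x : X) :
    ¬ ContinuousAt φ x := fun hφ => by
  have key : ∀ c : ℝ, Dense {y | φ y = c} → φ x = c := fun c hc => by
    by_contra h
    exact mem_closure_iff_frequently.1 (hc x) (hφ.eventually_ne h)
  exact hab ((key a ha).symm.trans (key b hb))

/-! ### Continuity of the law of a sample -/

/-- If `μ ≤ ν + κ` and `κ` has mass `δ`, the `n`-fold products of the probability measures `μ`
and `ν` satisfy `μⁿ s ≤ νⁿ s + n δ`. -/
lemma pi_apply_le_of_le_add {α : Type*} [MeasurableSpace α] {μ ν κ : Measure α}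
    [IsProbabilityMeasure μ] [IsProbabilityMeasure ν] (h : μ ≤ ν + κ) (n : ℕ)
    {s : Set (Fin n → α)} (hs : MeasurableSet s) :
    Measure.pi (fun _ => μ) s ≤ Measure.pi (fun _ => ν) s + n * κ Set.univ := by
  induction n with
  | zero =>
    refine le_add_right (le_of_eq ?_)
    rw [Measure.pi_of_empty _ (fun i => i.elim0), Measure.pi_of_empty _ (fun i => i.elim0)]
  | succ n ih =>
    set e := MeasurableEquiv.piFinSuccAbove (fun _ : Fin (n + 1) => α) 0 with he
    set t : Set (α × (Fin n → α)) := e.symm ⁻¹' s with ht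
    have htm : MeasurableSet t := e.symm.measurable hs
    have hst : s = e ⁻¹' t := by
      rw [ht, ← Set.preimage_comp, MeasurableEquiv.symm_comp_self, Set.preimage_id]
    have key : ∀ (ρ : Measure α) [IsProbabilityMeasure ρ], Measure.pi (fun _ : Fin (n + 1) => ρ) s =
        ∫⁻ x, Measure.pi (fun _ : Fin n => ρ) (Prod.mk x ⁻¹' t) ∂ρ := fun ρ _ => by
      rw [hst, (measurePreserving_piFinSuccAbove (fun _ : Fin (n + 1) => ρ) 0).measure_preimage
        htm.nullMeasurableSet, Measure.prod_apply htm]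
    rw [key μ, key ν]
    -- The last `n` coordinates are exchanged by induction, then the first; the latter costs at most
    -- the mass of `κ`, the integrand being a probability.
    calc ∫⁻ x, Measure.pi (fun _ : Fin n => μ) (Prod.mk x ⁻¹' t) ∂μ
        ≤ ∫⁻ x, (Measure.pi (fun _ : Fin n => ν) (Prod.mk x ⁻¹' t) + n * κ Set.univ) ∂μ :=
          lintegral_mono fun x => ih (measurable_prodMk_left htm)
      _ = ∫⁻ x, Measure.pi (fun _ : Fin n => ν) (Prod.mk x ⁻¹' t) ∂μ + n * κ Set.univ := by
          rw [lintegral_add_right _ measurable_const, lintegral_const, measure_univ (μ := μ),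
            mul_one]
      _ ≤ (∫⁻ x, Measure.pi (fun _ : Fin n => ν) (Prod.mk x ⁻¹' t) ∂ν + κ Set.univ) +
            n * κ Set.univ := by
          gcongr
          refine (lintegral_mono' h le_rfl).trans ?_
          rw [lintegral_add_measure]
          gcongr
          exact (lintegral_mono fun x => prob_le_one).trans (by simp)
      _ = _ := by push_cast; ring

namespace Density

variable {d : ℕ}

lemma law_le_law_add (f g : Density d) :
    f.law ≤ g.law + volume.withDensity fun x => ‖(f.1 - g.1) x‖ₑ := by
  rw [law, law, ← withDensity_add_left (by fun_prop)]
  refine withDensity_mono ?_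
  filter_upwards [Lp.coeFn_sub f.1 g.1] with x hx
  rw [Pi.add_apply, hx, Pi.sub_apply, ← ofReal_norm]
  refine le_trans (ENNReal.ofReal_le_ofReal ?_) ENNReal.ofReal_add_le
  linarith [Real.le_norm_self (f.1 x - g.1 x)]

/-- The probability of an event for a sample of size `n` is a Lipschitz function of the density. -/
lemma lipschitzWith_pi_law_real {n : ℕ} {s : Set (Fin n → EuclideanSpace ℝ (Fin d))}
    (hs : MeasurableSet s) :
    LipschitzWith n fun f : Density d => (Measure.pi fun _ : Fin n => f.law).real s := by
  refine LipschitzWith.of_le_add_mul _ fun f g => ?_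
  have h := pi_apply_le_of_le_add (f.law_le_law_add g) n hs
  have hκ : (volume.withDensity fun x => ‖(f.1 - g.1) x‖ₑ) Set.univ =
      ENNReal.ofReal (dist f g) := by
    rw [withDensity_apply _ MeasurableSet.univ, Measure.restrict_univ, Subtype.dist_eq,
      dist_eq_norm, L1.norm_def, ENNReal.ofReal_toReal]
    exact (L1.integrable_coeFn (f.1 - g.1)).2.ne
  rw [hκ] at h
  have h' := ENNReal.toReal_mono (by finiteness) h
  rwa [ENNReal.toReal_add (by finiteness) (by finiteness), ENNReal.toReal_mul,
    ENNReal.toReal_natCast, ENNReal.toReal_ofReal dist_nonneg] at h'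

/-! ### Completeness, density and the Baire category argument -/

instance completeSpace : CompleteSpace (Density d) := by
  have h0 : {f : Lp ℝ 1 (volume : Measure (EuclideanSpace ℝ (Fin d))) | ∀ᵐ x, 0 ≤ f x} =
      Set.Ici 0 := by
    ext f
    rw [Set.mem_Ici, ← Lp.coeFn_nonneg]
    rfl
  have h : IsClosed {f : Lp ℝ 1 (volume : Measure (EuclideanSpace ℝ (Fin d))) |
      (∀ᵐ x, 0 ≤ f x) ∧ ∫ x, f x = 1} := by
    refine IsClosed.inter
      (s₁ := {f : Lp ℝ 1 (volume : Measure (EuclideanSpace ℝ (Fin d))) | ∀ᵐ x, 0 ≤ f x})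
      (s₂ := {f : Lp ℝ 1 (volume : Measure (EuclideanSpace ℝ (Fin d))) | ∫ x, f x = 1}) ?_ ?_
    · rw [h0]
      exact isClosed_Ici
    · exact isClosed_eq continuous_integral continuous_const
  exact h.completeSpace_coe

lemma dense_of_forall_exists {p : Density d → Prop}
    (h : ∀ f : Density d, ∀ ε : ℝ, 0 < ε → ∃ g : Density d, ‖f.1 - g.1‖ < ε ∧ p g) :
    Dense {f : Density d | p f} := by
  refine Metric.dense_iff.2 fun f ε hε => ?_
  obtain ⟨g, hg, hp⟩ := h f ε hε
  exact ⟨g, by rwa [Metric.mem_ball, dist_comm, Subtype.dist_eq, dist_eq_norm], hp⟩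

lemma dense_zeroReach_eq_one [NeZero d] : Dense {f : Density d | zeroReach f = 1} :=
  dense_of_forall_exists fun f _ hε =>
    let ⟨g, hg, _, h⟩ := f.exists_reach_eq_zero hε
    ⟨g, hg, by simp [zeroReach, h]⟩

lemma dense_zeroReach_eq_zero [NeZero d] : Dense {f : Density d | zeroReach f = 0} :=
  dense_of_forall_exists fun f _ hε =>
    let ⟨g, hg, _, h⟩ := f.exists_reach_eq_top hε
    ⟨g, hg, by simp [zeroReach, h]⟩

/-- A functional that takes the values `0` and `1` only, each on a dense set of densities, is not
consistently estimable. -/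
lemma not_consistentlyEstimable_of_dense [Nonempty (Density d)] {Φ : Density d → ℝ}
    (h01 : ∀ f, Φ f = 0 ∨ Φ f = 1)
    (h0 : Dense {f | Φ f = 0}) (h1 : Dense {f | Φ f = 1}) :
    ¬ ConsistentlyEstimable Φ := by
  rintro ⟨T, hT, hlim⟩
  let s : (n : ℕ) → Set (Fin n → EuclideanSpace ℝ (Fin d)) := fun n => {x | 1 / 2 ≤ T n x}
  have hs : ∀ n, MeasurableSet (s n) := fun n => measurableSet_le measurable_const (hT n)
  let F : ℕ → Density d → ℝ := fun n f => (Measure.pi fun _ : Fin n => f.law).real (s n)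
  have hF : ∀ n, Continuous (F n) := fun n => (lipschitzWith_pi_law_real (hs n)).continuous
  have hlim' : ∀ f, Tendsto (fun n => (Measure.pi fun _ : Fin n => f.law).real
      {x | 1 / 2 ≤ |T n x - Φ f|}) atTop (𝓝 0) := fun f =>
    (ENNReal.tendsto_toReal ENNReal.zero_ne_top).comp (hlim f (1 / 2) (by norm_num))
  have hF0 : ∀ f, Φ f = 0 → ∀ᶠ n in atTop, F n f ≤ 1 / 3 := fun f hf => by
    filter_upwards [(hlim' f).eventually_le_const (by norm_num : (0 : ℝ) < 1 / 3)] with n hn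
    refine (measureReal_mono fun x hx => ?_).trans hn
    have hx' : 1 / 2 ≤ T n x := hx
    exact hx'.trans (by simpa [hf] using le_abs_self (T n x))
  have hF1 : ∀ f, Φ f = 1 → ∀ᶠ n in atTop, 2 / 3 ≤ F n f := fun f hf => by
    filter_upwards [(hlim' f).eventually_le_const (by norm_num : (0 : ℝ) < 1 / 3)] with n hn
    have hle : (Measure.pi fun _ : Fin n => f.law).real (s n)ᶜ ≤ 1 / 3 := by
      refine (measureReal_mono fun x hx => ?_).trans hn
      have hx' : T n x < 1 / 2 := not_le.1 hx
      change 1 / 2 ≤ |T n x - Φ f|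
      rw [hf, abs_sub_comm]
      exact le_trans (by linarith) (le_abs_self _)
    rw [probReal_compl_eq_one_sub (hs n)] at hle
    change 2 / 3 ≤ (Measure.pi fun _ : Fin n => f.law).real (s n)
    linarith
  -- Countably many closed sets, on each of which `F n` stays low or stays high from some index on.
  -- They cover the space, so one has interior, where a density with the opposite value gives a
  -- contradiction.
  let C : ℕ ⊕ ℕ → Set (Density d) := Sum.elim
    (fun N => ⋂ n ≥ N, {f | F n f ≤ 1 / 3}) (fun N => ⋂ n ≥ N, {f | 2 / 3 ≤ F n f})
  have hC : ∀ i, IsClosed (C i) := by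
    rintro (N | N)
    · exact isClosed_biInter fun n _ => isClosed_le (hF n) continuous_const
    · exact isClosed_biInter fun n _ => isClosed_le continuous_const (hF n)
  have hU : ⋃ i, C i = Set.univ := Set.eq_univ_of_forall fun f => by
    rcases h01 f with hf | hf
    · obtain ⟨N, hN⟩ := eventually_atTop.1 (hF0 f hf)
      exact Set.mem_iUnion.2 ⟨Sum.inl N, Set.mem_iInter₂.2 hN⟩
    · obtain ⟨N, hN⟩ := eventually_atTop.1 (hF1 f hf)
      exact Set.mem_iUnion.2 ⟨Sum.inr N, Set.mem_iInter₂.2 hN⟩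
  obtain ⟨i | i, hi⟩ := nonempty_interior_of_iUnion_of_closed hC hU
  · obtain ⟨f, hfi, hf⟩ := h1.inter_open_nonempty _ isOpen_interior hi
    obtain ⟨n, hn, hni⟩ := ((hF1 f hf).and (eventually_ge_atTop i)).exists
    have : F n f ≤ 1 / 3 := Set.mem_iInter₂.1 (interior_subset hfi) n hni
    linarith
  · obtain ⟨f, hfi, hf⟩ := h0.inter_open_nonempty _ isOpen_interior hi
    obtain ⟨n, hn, hni⟩ := ((hF0 f hf).and (eventually_ge_atTop i)).exists
    have : 2 / 3 ≤ F n f := Set.mem_iInter₂.1 (interior_subset hfi) n hni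
    linarith

lemma nonempty_density : Nonempty (Density d) := by
  set B := Metric.ball (0 : EuclideanSpace ℝ (Fin d)) 1
  have hB : volume B ≠ ∞ := Metric.isBounded_ball.measure_lt_top.ne
  have hB0 : volume.real B ≠ 0 :=
    (ENNReal.toReal_pos (Metric.measure_ball_pos _ _ one_pos).ne' hB).ne'
  have hae := indicatorConstLp_coeFn (p := 1) (hs := Metric.isOpen_ball.measurableSet)
    (hμs := hB) (c := (volume.real B)⁻¹)
  refine ⟨⟨indicatorConstLp 1 Metric.isOpen_ball.measurableSet hB (volume.real B)⁻¹, ?_, ?_⟩⟩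
  · filter_upwards [hae] with x hx
    rw [hx]
    exact Set.indicator_nonneg (fun _ _ => inv_nonneg.2 measureReal_nonneg) x
  · rw [integral_congr_ae hae, integral_indicator Metric.isOpen_ball.measurableSet,
      setIntegral_const, smul_eq_mul, mul_inv_cancel₀ hB0]

end Density

theorem mainTheorem3 (d : ℕ) (hd : 1 ≤ d) :
    (∀ f : Density d, 0 < reach f.supp →
      ∀ δ : ℝ, 0 < δ →
        ∃ g : Density d, ‖f.1 - g.1‖ < δ ∧ IsCompact g.supp ∧ reach g.supp = 0) ∧
    (∀ f : Density d, reach f.supp = 0 →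
      ∀ ε : ℝ, 0 < ε →
        ∃ g : Density d, ‖f.1 - g.1‖ < ε ∧ IsCompact g.supp ∧ 0 < reach g.supp) ∧
    (∀ f : Density d, ¬ ContinuousAt (Density.zeroReach (d := d)) f) ∧
    ¬ Density.ConsistentlyEstimable (Density.zeroReach (d := d)) := by
  have : NeZero d := ⟨Nat.one_le_iff_ne_zero.1 hd⟩
  have := Density.nonempty_density (d := d)
  refine ⟨fun f _ δ hδ => f.exists_reach_eq_zero hδ, fun f _ ε hε => ?_,
    not_continuousAt_of_dense zero_ne_one Density.dense_zeroReach_eq_zero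
      Density.dense_zeroReach_eq_one,
    Density.not_consistentlyEstimable_of_dense (fun f => ?_) Density.dense_zeroReach_eq_zero
      Density.dense_zeroReach_eq_one⟩
  · obtain ⟨g, hg, hc, hr⟩ := f.exists_reach_eq_top hε
    exact ⟨g, hg, hc, hr ▸ ENNReal.zero_lt_top⟩
  · unfold Density.zeroReach
    split_ifs <;> simp
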